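/- Let $\mu,\xi>0$, and let $(X(t))_{t\ge 0}$ be a continuous-time Markov chain on $\{1,2\}$ with right-continuous paths and generator matrix $$\mathbf Q=\begin{pmatrix}-\mu&\mu\\ \xi&-\xi\end{pmatrix},$$ that is, a time-homogeneous Markov process with transition matrices $e^{t\mathbf Q}$. Let $S_{\mathrm i}=X(0)$ and $S_{\mathrm f}=X(1)$ be the initial and the final state on $[0,1]$, and let $\eta_1=\int_0^1 \mathbf 1_{\{X(t)=1\}}\,dt$ be the time spent in state $1$. For $i,j\in\{1,2\}$ with $\Pr(S_{\mathrm i}=i)>0$, let $f_{\eta_1,S_{\mathrm f}|S_{\mathrm i}}(r,j|i)\,dr$ denote the measure $A\mapsto \Pr(\eta_1\in A,\ S_{\mathrm f}=j\mid S_{\mathrm i}=i)$ on the Borel sets of $\mathbb R$. This measure is concentrated on $[0,1]$ and is given there by $$\begin{aligned} f_{\eta_1,S_{\mathrm f}|S_{\mathrm i}}(r,1|1)&=e^{-\mu r-\xi(1-r)}\left(\delta(1-r)+\sqrt{\frac{\mu\xi r}{1-r}}\;I_1\!\left(2\sqrt{\mu\xi r(1-r)}\right)\right),\\ f_{\eta_1,S_{\mathrm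 f}|S_{\mathrm i}}(r,2|1)&=\mu e^{-\mu r-\xi(1-r)}\,I_0\!\left(2\sqrt{\mu\xi r(1-r)}\right),\\ f_{\eta_1,S_{\mathrm f}|S_{\mathrm i}}(r,1|2)&=\xi e^{-\mu r-\xi(1-r)}\,I_0\!\left(2\sqrt{\mu\xi r(1-r)}\right),\\ f_{\eta_1,S_{\mathrm f}|S_{\mathrm i}}(r,2|2)&=e^{-\mu r-\xi(1-r)}\left(\delta(r)+\sqrt{\frac{\mu\xi(1-r)}{r}}\;I_1\!\left(2\sqrt{\mu\xi r(1-r)}\right)\right), \end{aligned}$$ where $\delta(1-r)$ and $\delta(r)$ stand for the unit point masses at $r=1$ and $r=0$, all other terms are densities with respect to Lebesgue measure on $(0,1)$, and $I_n(x)=\sum_{m\ge 0}\frac{(x/2)^{2m+n}}{m!\,(m+n)!}$ is the modified Bessel function of the first kind of order $n$. -/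

import Mathlib

open MeasureTheory ProbabilityTheory Filter Topology Set
open scoped NNReal ENNReal

/-- `Q` is the infinitesimal generator of a chain on a finite state space: off-diagonal entries
are nonnegative and rows sum to zero. -/
structure IsGenerator {S : Type*} [Fintype S] (Q : Matrix S S ℝ) : Prop where
  offDiag_nonneg : ∀ i j, i ≠ j → 0 ≤ Q i j
  row_sum : ∀ i, ∑ j, Q i j = 0

/-- `X` is a continuous-time Markov chain on the finite state space `S`, with generator `Q` and
arbitrary initial law, under the probability measure `P`: its paths are almost surely
right-continuous step functions, and its finite-dimensional distributions are those of a
time-homogeneous Markov chain with transition matrices `exp (t Q)`. -/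
structure IsCTMC {Ω S : Type*} [MeasurableSpace Ω] [Fintype S] [DecidableEq S]
    [MeasurableSpace S] (Q : Matrix S S ℝ) (X : ℝ≥0 → Ω → S) (P : Measure Ω) : Prop where
  generator : IsGenerator Q
  measurable : ∀ t, Measurable (X t)
  /-- For the discrete topology on `S`, this is right-continuity of the path at every time. -/
  right_continuous : ∀ᵐ ω ∂P, ∀ t : ℝ≥0, ∀ᶠ s in 𝓝[>] t, X s ω = X t ω
  /-- For `t₀ ≤ t₁ ≤ ⋯ ≤ tₙ`, the probability of `X t₀ = x₀, …, X tₙ = xₙ` is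
  `P (X t₀ = x₀)` times the product of the one-step transition probabilities. -/
  markov : ∀ (n : ℕ) (t : Fin (n + 1) → ℝ≥0), Monotone t → ∀ x : Fin (n + 1) → S,
    P.real {ω | ∀ k, X (t k) ω = x k} =
      P.real {ω | X (t 0) ω = x 0} *
        ∏ k : Fin n,
          NormedSpace.exp (((t k.succ : ℝ) - (t k.castSucc : ℝ)) • Q) (x k.castSucc) (x k.succ)

/-- The generator `[[-μ, μ], [ξ, -ξ]]` of a two-state chain.
The first state is `0 : Fin 2`, the second state is `1 : Fin 2`. -/
def twoStateGenerator (μ ξ : ℝ) : Matrix (Fin 2) (Fin 2) ℝ := !![-μ, μ; ξ, -ξ]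

/-- The time that `X` spends in state `i` during `[0, 1]`, defined pathwise. -/
noncomputable def occupationTime {Ω S : Type*} (X : ℝ≥0 → Ω → S) (i : S) (ω : Ω) : ℝ :=
  ∫ t in (0 : ℝ)..1, Set.indicator {s : ℝ | X s.toNNReal ω = i} (fun _ => (1 : ℝ)) t

/-- The joint law of the occupation time of the first state over `[0, 1]` and of the final state,
conditioned on the initial state: the measure
`A ↦ P (η₁ ∈ A, X 1 = j | X 0 = i)` on the real line. -/
noncomputable def occupationLaw {Ω : Type*} [MeasurableSpace Ω] (P : Measure Ω)
    (X : ℝ≥0 → Ω → Fin 2) (i j : Fin 2) : Measure ℝ :=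
  ((ProbabilityTheory.cond P {ω | X 0 ω = i}).restrict {ω | X 1 ω = j}).map (occupationTime X 0)

/-- The modified Bessel function of the first kind `I_n`, of integer order `n ≥ 0`:
`I_n(x) = ∑ₘ (x/2)^(2m+n) / (m! (m+n)!)`. -/
noncomputable def besselI (n : ℕ) (x : ℝ) : ℝ :=
  ∑' m : ℕ, (x / 2) ^ (2 * m + n) / ((m.factorial : ℝ) * ((m + n).factorial : ℝ))

/-! A finite measure on the line with finite exponential moments is determined by its moment
generating function, so it suffices to compute E[e^{sη₁}; X(1) = j | X(0) = i] for all real s. By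
Feynman–Kac (`IsCTMC.integral_exp_occupationTime`) this is the (i, j) entry of exp(Q + sE), where E
is the projection onto the first state: on a grid of mesh 1/n the Markov property gives the entry of
(e^{Q/n} e^{sE/n})^n, and the Lie–Trotter formula gives the limit.

It remains to see that the transforms of the claimed measures are these entries. With [0, t] in
place of [0, 1] and u the fraction of time spent in the initial state, they become integrals over u
∈ [0, 1] of kernels depending on t. These satisfy the linear system f' = fA with A = Q + sE
(`hasDerivAt_integral_switchKernel`, `hasDerivAt_integral_returnKernel`), hence equal a row of
e^{tA}; t = 1 is the claim. -/

/-! ### Bessel functions as power series in z. -/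

/-- The entire function `z ↦ ∑ₘ zᵐ / (m! (m+p)!)`, for which `I_p(2√z) = z^(p/2) besselSeries p z`. -/
noncomputable def besselSeries (p : ℕ) (z : ℝ) : ℝ :=
  ∑' m : ℕ, z ^ m / ((m.factorial : ℝ) * ((m + p).factorial : ℝ))

lemma summable_besselSeries (p : ℕ) (z : ℝ) :
    Summable fun m : ℕ => z ^ m / ((m.factorial : ℝ) * ((m + p).factorial : ℝ)) := by
  refine Summable.of_norm_bounded (Real.summable_pow_div_factorial |z|) fun m => ?_
  rw [norm_div, norm_pow, Real.norm_eq_abs, Real.norm_of_nonneg (by positivity)]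
  gcongr
  exact le_mul_of_one_le_right (by positivity)
    (by exact_mod_cast Nat.one_le_iff_ne_zero.2 (Nat.factorial_ne_zero _))

lemma besselSeries_nonneg (p : ℕ) {z : ℝ} (hz : 0 ≤ z) : 0 ≤ besselSeries p z :=
  tsum_nonneg fun _ => by positivity

lemma succ_mul_div_factorial_mul (p m : ℕ) (z : ℝ) :
    ((m + 1 : ℕ) : ℝ) * z ^ (m + 1 - 1) / (((m + 1).factorial : ℝ) * ((m + 1 + p).factorial : ℝ)) =
      z ^ m / ((m.factorial : ℝ) * ((m + (p + 1)).factorial : ℝ)) := by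
  rw [Nat.factorial_succ m, show m + 1 + p = m + (p + 1) by ring, Nat.add_sub_cancel]
  push_cast
  field_simp

/-- Differentiating termwise shifts m by one and raises p by one. The terms at radius |z| + 1 give a
uniform summable majorant. -/
lemma hasDerivAt_besselSeries (p : ℕ) (z : ℝ) :
    HasDerivAt (besselSeries p) (besselSeries (p + 1) z) z := by
  set R : ℝ := |z| + 1 with hR
  have hR0 : 0 < R := by positivity
  have key (w : ℝ) : Summable fun m : ℕ =>
      (m : ℝ) * w ^ (m - 1) / ((m.factorial : ℝ) * ((m + p).factorial : ℝ)) := by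
    rw [← summable_nat_add_iff 1]
    exact (summable_besselSeries (p + 1) w).congr fun m => (succ_mul_div_factorial_mul p m w).symm
  have h := hasDerivAt_tsum_of_isPreconnected (𝕜 := ℝ) (t := Metric.ball (0 : ℝ) R) (y₀ := 0) (y := z)
    (g := fun (m : ℕ) z => z ^ m / ((m.factorial : ℝ) * ((m + p).factorial : ℝ)))
    (g' := fun (m : ℕ) z => (m : ℝ) * z ^ (m - 1) / ((m.factorial : ℝ) * ((m + p).factorial : ℝ)))
    (key R) Metric.isOpen_ball
    (convex_ball _ _).isPreconnected (fun m w _ => (hasDerivAt_pow m w).div_const _)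
    (fun m w hw => ?_) (by simpa using hR0) (summable_besselSeries p 0)
    (by simp only [Metric.mem_ball, dist_zero_right, Real.norm_eq_abs]; linarith)
  · refine h.congr_deriv ?_
    rw [(key z).tsum_eq_zero_add]
    simp only [succ_mul_div_factorial_mul]
    simp [besselSeries]
  · rw [norm_div, norm_mul, norm_pow, Real.norm_of_nonneg (r := (_ : ℝ) * _) (by positivity),
      Real.norm_of_nonneg (r := (m : ℝ)) (by positivity)]
    have : ‖w‖ ≤ R := by simpa using (mem_ball_zero_iff.1 hw).le
    gcongr

lemma besselSeries_apply_zero (p : ℕ) : besselSeries p 0 = 1 / (p.factorial : ℝ) := by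
  rw [besselSeries, tsum_eq_single 0 fun m hm => by simp [hm]]
  simp

lemma continuous_besselSeries (p : ℕ) : Continuous (besselSeries p) :=
  continuous_iff_continuousAt.2 fun z => (hasDerivAt_besselSeries p z).continuousAt

/-- This is the recurrence I₀(w) - I₂(w) = (2/w) I₁(w) at w = 2√z. Termwise, 1/(m! m!) = (m + 1)/(m!
(m+1)!), and the part with numerator m is the series for p = 2, shifted. -/
lemma besselSeries_zero_eq (z : ℝ) :
    besselSeries 0 z = besselSeries 1 z + z * besselSeries 2 z := by
  have h2 : Summable fun m : ℕ =>
      (m : ℝ) * z ^ m / ((m.factorial : ℝ) * ((m + 1).factorial : ℝ)) := by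
    rw [← summable_nat_add_iff 1]
    refine ((summable_besselSeries 2 z).mul_left z).congr fun m => ?_
    rw [← succ_mul_div_factorial_mul 1 m z, Nat.add_sub_cancel]
    ring
  have e2 : z * besselSeries 2 z =
      ∑' m : ℕ, (m : ℝ) * z ^ m / ((m.factorial : ℝ) * ((m + 1).factorial : ℝ)) := by
    rw [h2.tsum_eq_zero_add, besselSeries, ← tsum_mul_left]
    simp only [CharP.cast_eq_zero, zero_mul, zero_div, zero_add]
    refine tsum_congr fun m => ?_
    rw [← succ_mul_div_factorial_mul 1 m z, Nat.add_sub_cancel]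
    ring
  rw [e2, besselSeries, besselSeries, ← (summable_besselSeries 1 z).tsum_add h2]
  refine tsum_congr fun m => ?_
  rw [Nat.factorial_succ m, add_zero]
  push_cast
  field_simp
  ring

lemma besselI_zero_two_mul_sqrt {z : ℝ} (hz : 0 ≤ z) :
    besselI 0 (2 * Real.sqrt z) = besselSeries 0 z := by
  refine tsum_congr fun m => ?_
  rw [mul_div_cancel_left₀ _ two_ne_zero, add_zero, pow_mul, Real.sq_sqrt hz]

lemma besselI_one_two_mul_sqrt {z : ℝ} (hz : 0 ≤ z) :
    besselI 1 (2 * Real.sqrt z) = Real.sqrt z * besselSeries 1 z := by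
  rw [besselSeries, ← tsum_mul_left]
  refine tsum_congr fun m => ?_
  rw [mul_div_cancel_left₀ _ two_ne_zero, pow_succ, pow_mul, Real.sq_sqrt hz]
  ring

/-! ### The two kernels and their differential equations in t. -/

/-- The kernel `t e^(t(xu + y(1-u))) I₀(2√(c t² u(1-u)))` on the unit interval. -/
noncomputable def switchKernel (x y c t u : ℝ) : ℝ :=
  t * Real.exp (t * (x * u + y * (1 - u))) * besselSeries 0 (c * t ^ 2 * u * (1 - u))

/-- The kernel `t √(c u/(1-u)) e^(t(xu + y(1-u))) I₁(2√(c t² u(1-u)))` on the unit interval. -/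
noncomputable def returnKernel (x y c t u : ℝ) : ℝ :=
  c * t ^ 2 * u * Real.exp (t * (x * u + y * (1 - u))) * besselSeries 1 (c * t ^ 2 * u * (1 - u))

lemma continuous_switchKernel (x y c t : ℝ) : Continuous (switchKernel x y c t) := by
  have := continuous_besselSeries 0
  unfold switchKernel; fun_prop

lemma continuous_returnKernel (x y c t : ℝ) : Continuous (returnKernel x y c t) := by
  have := continuous_besselSeries 1
  unfold returnKernel; fun_prop

/-- The dominating constant is the bound of F' on the compact set of times within 1 of t and points
between a and b. -/
lemma hasDerivAt_intervalIntegral_of_continuous {F F' : ℝ → ℝ → ℝ}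
    (hF : ∀ t, Continuous (F t)) (hF' : Continuous (Function.uncurry F'))
    (hd : ∀ t u, HasDerivAt (fun t => F t u) (F' t u) t) (a b t : ℝ) :
    HasDerivAt (fun t => ∫ u in a..b, F t u) (∫ u in a..b, F' t u) t := by
  have hK : IsCompact (Metric.closedBall t 1 ×ˢ uIcc a b) :=
    (isCompact_closedBall t 1).prod isCompact_uIcc
  obtain ⟨C, hC⟩ := hK.exists_bound_of_continuousOn hF'.continuousOn
  refine (intervalIntegral.hasDerivAt_integral_of_dominated_loc_of_deriv_le
    (s := Metric.closedBall t 1) (bound := fun _ => C) (Metric.closedBall_mem_nhds t one_pos)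
    (Eventually.of_forall fun s => (hF s).aestronglyMeasurable)
    ((hF t).intervalIntegrable _ _) ?_ ?_ intervalIntegrable_const ?_).2
  · exact (hF'.comp (Continuous.prodMk_right t)).aestronglyMeasurable
  · exact ae_of_all _ fun u hu s hs => hC (s, u) ⟨hs, uIoc_subset_uIcc hu⟩
  · exact ae_of_all _ fun u _ s _ => hd s u

lemma hasDerivAt_exp_kernel_left (x y t u : ℝ) :
    HasDerivAt (fun t => Real.exp (t * (x * u + y * (1 - u))))
      (Real.exp (t * (x * u + y * (1 - u))) * (x * u + y * (1 - u))) t := by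
  simpa using ((hasDerivAt_id t).mul_const (x * u + y * (1 - u))).exp

lemma hasDerivAt_exp_kernel_right (x y t u : ℝ) :
    HasDerivAt (fun u => Real.exp (t * (x * u + y * (1 - u))))
      (Real.exp (t * (x * u + y * (1 - u))) * (t * (x - y))) u := by
  have h : HasDerivAt (fun u : ℝ => t * (x * u + y * (1 - u))) (t * (x - y)) u := by
    have := ((((hasDerivAt_id u).const_mul x).add
      (((hasDerivAt_id u).const_sub 1).const_mul y)).const_mul t)
    exact this.congr_deriv (by ring)
  exact h.exp

lemma hasDerivAt_bessel_kernel_left (p : ℕ) (c t u : ℝ) :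
    HasDerivAt (fun t => besselSeries p (c * t ^ 2 * u * (1 - u)))
      (besselSeries (p + 1) (c * t ^ 2 * u * (1 - u)) * (2 * c * t * u * (1 - u))) t := by
  have h : HasDerivAt (fun t : ℝ => c * t ^ 2 * u * (1 - u)) (2 * c * t * u * (1 - u)) t := by
    have := ((((hasDerivAt_pow 2 t).const_mul c).mul_const u).mul_const (1 - u))
    exact this.congr_deriv (by push_cast; ring)
  exact (hasDerivAt_besselSeries p _).comp t h

lemma hasDerivAt_bessel_kernel_right (p : ℕ) (c t u : ℝ) :
    HasDerivAt (fun u => besselSeries p (c * t ^ 2 * u * (1 - u)))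
      (besselSeries (p + 1) (c * t ^ 2 * u * (1 - u)) * (c * t ^ 2 * (1 - 2 * u))) u := by
  have h : HasDerivAt (fun u : ℝ => c * t ^ 2 * u * (1 - u)) (c * t ^ 2 * (1 - 2 * u)) u := by
    have := ((hasDerivAt_id u).const_mul (c * t ^ 2)).mul ((hasDerivAt_id u).const_sub 1)
    exact this.congr_deriv (by simp only [id]; ring)
  exact (hasDerivAt_besselSeries p _).comp u h

/-- The t-derivative of the kernel equals y times itself, plus the return kernel, plus an exact
u-derivative whose boundary values produce e^{xt}. -/
lemma hasDerivAt_integral_switchKernel (x y c t : ℝ) :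
    HasDerivAt (fun t => ∫ u in (0 : ℝ)..1, switchKernel x y c t u)
      (y * (∫ u in (0 : ℝ)..1, switchKernel x y c t u) +
        (Real.exp (x * t) + ∫ u in (0 : ℝ)..1, returnKernel x y c t u)) t := by
  have c0 := continuous_besselSeries 0
  have c1 := continuous_besselSeries 1
  have h := hasDerivAt_intervalIntegral_of_continuous
    (continuous_switchKernel x y c) (F' := fun t u =>
      (1 * Real.exp (t * (x * u + y * (1 - u))) +
        t * (Real.exp (t * (x * u + y * (1 - u))) * (x * u + y * (1 - u)))) *
        besselSeries 0 (c * t ^ 2 * u * (1 - u)) +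
      t * Real.exp (t * (x * u + y * (1 - u))) *
        (besselSeries 1 (c * t ^ 2 * u * (1 - u)) * (2 * c * t * u * (1 - u))))
    (by unfold Function.uncurry; fun_prop)
    (fun t u => ((hasDerivAt_id t).mul (hasDerivAt_exp_kernel_left x y t u)).mul
      (hasDerivAt_bessel_kernel_left 0 c t u)) 0 1 t
  refine h.congr_deriv ?_
  obtain ⟨W, hW⟩ : ∃ W : ℝ → ℝ, W = fun u =>
      ((1 * Real.exp (t * (x * u + y * (1 - u))) +
        u * (Real.exp (t * (x * u + y * (1 - u))) * (t * (x - y)))) *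
        besselSeries 0 (c * t ^ 2 * u * (1 - u)) +
      u * Real.exp (t * (x * u + y * (1 - u))) *
        (besselSeries 1 (c * t ^ 2 * u * (1 - u)) * (c * t ^ 2 * (1 - 2 * u)))) :=
    ⟨_, rfl⟩
  have iE : IntervalIntegrable W volume 0 1 :=
    Continuous.intervalIntegrable (by rw [hW]; fun_prop) 0 1
  -- The primitive vanishes at u = 0 and equals e^{xt} at u = 1, since the Bessel argument is 0
  -- there.
  have hd (u : ℝ) : HasDerivAt (fun u => u * Real.exp (t * (x * u + y * (1 - u))) *
      besselSeries 0 (c * t ^ 2 * u * (1 - u))) (W u) u := by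
    rw [hW]
    exact ((hasDerivAt_id u).mul (hasDerivAt_exp_kernel_right x y t u)).mul
      (hasDerivAt_bessel_kernel_right 0 c t u)
  have hE : Real.exp (x * t) = ∫ u in (0 : ℝ)..1, W u := by
    rw [intervalIntegral.integral_eq_sub_of_hasDerivAt (fun u _ => hd u) iE]
    simp [besselSeries_apply_zero, mul_comm x t]
  have i0 := (continuous_switchKernel x y c t).intervalIntegrable (μ := volume) 0 1
  have i1 := (continuous_returnKernel x y c t).intervalIntegrable (μ := volume) 0 1
  rw [hE, ← intervalIntegral.integral_const_mul, ← intervalIntegral.integral_add iE i1,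
    ← intervalIntegral.integral_add (i0.const_mul y) (iE.add i1)]
  refine intervalIntegral.integral_congr fun u _ => ?_
  simp only [hW, switchKernel, returnKernel]
  ring

/-- Again the integrands differ by an exact u-derivative; here the factor u(1 - u) kills both
boundary values. The recurrence `besselSeries_zero_eq` matches the orders 0, 1 and 2. -/
lemma hasDerivAt_integral_returnKernel (x y c t : ℝ) :
    HasDerivAt (fun t => Real.exp (x * t) + ∫ u in (0 : ℝ)..1, returnKernel x y c t u)
      (x * (Real.exp (x * t) + ∫ u in (0 : ℝ)..1, returnKernel x y c t u) +
        c * ∫ u in (0 : ℝ)..1, switchKernel x y c t u) t := by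
  have c1 := continuous_besselSeries 1
  have c2 := continuous_besselSeries 2
  have hsq (t : ℝ) : HasDerivAt (fun t : ℝ => t ^ 2) (2 * t) t := by
    simpa using hasDerivAt_pow 2 t
  have h := hasDerivAt_intervalIntegral_of_continuous
    (continuous_returnKernel x y c) (F' := fun t u =>
      (c * (2 * t) * u * Real.exp (t * (x * u + y * (1 - u))) +
        c * t ^ 2 * u * (Real.exp (t * (x * u + y * (1 - u))) * (x * u + y * (1 - u)))) *
        besselSeries 1 (c * t ^ 2 * u * (1 - u)) +
      c * t ^ 2 * u * Real.exp (t * (x * u + y * (1 - u))) *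
        (besselSeries 2 (c * t ^ 2 * u * (1 - u)) * (2 * c * t * u * (1 - u))))
    (by unfold Function.uncurry; fun_prop)
    (fun t u => by
      unfold returnKernel
      exact ((((hsq t).const_mul c).mul_const u).mul
        (hasDerivAt_exp_kernel_left x y t u)).mul (hasDerivAt_bessel_kernel_left 1 c t u)) 0 1 t
  have hexp : HasDerivAt (fun t => Real.exp (x * t)) (Real.exp (x * t) * x) t := by
    simpa using ((hasDerivAt_id t).const_mul x).exp
  refine (hexp.add h).congr_deriv ?_
  have hq (u : ℝ) : HasDerivAt (fun u : ℝ => u * (1 - u)) (1 - 2 * u) u :=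
    ((hasDerivAt_id u).mul ((hasDerivAt_id u).const_sub 1)).congr_deriv (by simp only [id]; ring)
  obtain ⟨W, hW⟩ : ∃ W : ℝ → ℝ, W = fun u =>
      (((1 - 2 * u) * Real.exp (t * (x * u + y * (1 - u))) +
        u * (1 - u) * (Real.exp (t * (x * u + y * (1 - u))) * (t * (x - y)))) *
        besselSeries 1 (c * t ^ 2 * u * (1 - u)) +
      u * (1 - u) * Real.exp (t * (x * u + y * (1 - u))) *
        (besselSeries 2 (c * t ^ 2 * u * (1 - u)) * (c * t ^ 2 * (1 - 2 * u)))) :=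
    ⟨_, rfl⟩
  have iE : IntervalIntegrable W volume 0 1 :=
    Continuous.intervalIntegrable (by rw [hW]; fun_prop) 0 1
  have hd (u : ℝ) : HasDerivAt (fun u => u * (1 - u) * Real.exp (t * (x * u + y * (1 - u))) *
      besselSeries 1 (c * t ^ 2 * u * (1 - u))) (W u) u := by
    rw [hW]
    exact ((hq u).mul (hasDerivAt_exp_kernel_right x y t u)).mul
      (hasDerivAt_bessel_kernel_right 1 c t u)
  have hE : ∫ u in (0 : ℝ)..1, W u = 0 := by
    rw [intervalIntegral.integral_eq_sub_of_hasDerivAt (fun u _ => hd u) iE]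
    simp
  have i0 := (continuous_switchKernel x y c t).intervalIntegrable (μ := volume) 0 1
  have i1 := (continuous_returnKernel x y c t).intervalIntegrable (μ := volume) 0 1
  -- The multiple -(ct) of this zero integral makes the two sides agree pointwise in u.
  rw [show c * ∫ u in (0 : ℝ)..1, switchKernel x y c t u =
      c * (∫ u in (0 : ℝ)..1, switchKernel x y c t u) + -(c * t) * ∫ u in (0 : ℝ)..1, W u by
        rw [hE, mul_zero, add_zero], mul_add, add_assoc, mul_comm x (Real.exp _)]
  congr 1
  rw [← intervalIntegral.integral_const_mul, ← intervalIntegral.integral_const_mul,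
    ← intervalIntegral.integral_const_mul,
    ← intervalIntegral.integral_add (i0.const_mul c) (iE.const_mul _),
    ← intervalIntegral.integral_add (i1.const_mul x) ((i0.const_mul c).add (iE.const_mul _))]
  refine intervalIntegral.integral_congr fun u _ => ?_
  simp only [hW, switchKernel, returnKernel, besselSeries_zero_eq]
  ring

/-! ### Product formula, path expansion and linear systems for matrix exponentials. -/

/-- F(h) and e^{hC} agree up to o(h). Powers up to n of their values at h = 1/n are uniformly
bounded, so the n-th powers differ by n · o(1/n), while (e^{C/n})^n = e^C. -/
lemma tendsto_pow_one_div_of_hasDerivAt {𝔸 : Type*} [NormedRing 𝔸] [NormOneClass 𝔸]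
    [NormedAlgebra ℝ 𝔸] [CompleteSpace 𝔸] {F : ℝ → 𝔸} {C : 𝔸} (h0 : F 0 = 1)
    (hF : HasDerivAt F C 0) :
    Tendsto (fun n : ℕ => F (1 / (n : ℝ)) ^ n) atTop (𝓝 (NormedSpace.exp C)) := by
  set G : ℝ → 𝔸 := fun h => NormedSpace.exp (h • C) with hG
  have hG0 : G 0 = 1 := by simp [hG, NormedSpace.exp_zero]
  have hGd : HasDerivAt G C 0 := by
    simpa [NormedSpace.exp_zero] using hasDerivAt_exp_smul_const (𝕂 := ℝ) C 0
  have hh : Tendsto (fun n : ℕ => 1 / (n : ℝ)) atTop (𝓝 0) := tendsto_one_div_atTop_nhds_zero_nat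
  -- uniform bound on powers
  have bound {H : ℝ → 𝔸} (h0 : H 0 = 1) (hH : HasDerivAt H C 0) :
      ∀ᶠ n : ℕ in atTop, ∀ k ≤ n, ‖H (1 / (n : ℝ)) ^ k‖ ≤ Real.exp (‖C‖ + 1) := by
    have h1 := hH.isLittleO.bound (c := 1) one_pos
    filter_upwards [hh.eventually h1, eventually_gt_atTop 0] with n hn hn0 k hk
    have hn0' : (0 : ℝ) < n := by exact_mod_cast hn0
    set h := 1 / (n : ℝ) with hdef
    have hpos : 0 < h := by positivity
    simp only [sub_zero, h0, one_mul, Real.norm_of_nonneg hpos.le] at hn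
    have h2 : ‖H h‖ ≤ 1 + h * (‖C‖ + 1) := by
      calc ‖H h‖ = ‖1 + h • C + (H h - 1 - h • C)‖ := by congr 1; abel
        _ ≤ ‖(1 : 𝔸)‖ + ‖h • C‖ + ‖H h - 1 - h • C‖ :=
            (norm_add_le _ _).trans (by gcongr; exact norm_add_le _ _)
        _ ≤ 1 + h * ‖C‖ + h := by
            rw [norm_one, norm_smul, Real.norm_of_nonneg hpos.le]; gcongr
        _ = _ := by ring
    calc ‖H h ^ k‖ ≤ ‖H h‖ ^ k := norm_pow_le _ _
      _ ≤ Real.exp (h * (‖C‖ + 1)) ^ k := by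
          gcongr; exact h2.trans (by linarith [Real.add_one_le_exp (h * (‖C‖ + 1))])
      _ = Real.exp (k * h * (‖C‖ + 1)) := by rw [← Real.exp_nat_mul]; ring_nf
      _ ≤ _ := by
          gcongr
          refine mul_le_of_le_one_left (by positivity) ?_
          rw [hdef, mul_one_div, div_le_one hn0']; exact_mod_cast hk
  -- Telescoping: Aⁿ - Bⁿ = ∑ Aᵏ (A - B) Bⁿ⁻¹⁻ᵏ.
  have tele (A B : 𝔸) (M : ℝ) (hM : 0 ≤ M) (n : ℕ) (hA : ∀ k ≤ n, ‖A ^ k‖ ≤ M)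
      (hB : ∀ k ≤ n, ‖B ^ k‖ ≤ M) : ‖A ^ n - B ^ n‖ ≤ n * (M * ‖A - B‖ * M) := by
    have hsum : A ^ n - B ^ n = ∑ k ∈ Finset.range n, A ^ k * (A - B) * B ^ (n - 1 - k) := by
      clear hA hB
      induction n with
      | zero => simp
      | succ n ih =>
        rw [Finset.sum_range_succ]
        have : ∑ k ∈ Finset.range n, A ^ k * (A - B) * B ^ (n + 1 - 1 - k) =
            (∑ k ∈ Finset.range n, A ^ k * (A - B) * B ^ (n - 1 - k)) * B := by
          rw [Finset.sum_mul]
          refine Finset.sum_congr rfl fun k hk => ?_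
          rw [mul_assoc _ _ B, ← pow_succ]
          congr 2
          have := Finset.mem_range.1 hk
          omega
        rw [this, ← ih]
        simp only [Nat.add_sub_cancel, Nat.sub_self, pow_zero, mul_one, pow_succ]
        noncomm_ring
    rw [hsum]
    refine (norm_sum_le _ _).trans ?_
    rw [← nsmul_eq_mul, ← Finset.card_range n, Finset.card_range]
    refine (Finset.sum_le_card_nsmul _ _ _ fun k hk => ?_).trans_eq (by rw [Finset.card_range])
    have := Finset.mem_range.1 hk
    refine (norm_mul_le _ _).trans ?_
    gcongr
    · exact (norm_mul_le _ _).trans (by gcongr; exact hA k (by omega))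
    · exact hB _ (by omega)
  have hdiff : (fun h => F h - G h) =o[𝓝 0] fun h : ℝ => h := by
    have := (hF.sub hGd).isLittleO
    simpa [h0, hG0] using this
  have hlim : Tendsto (fun n : ℕ => F (1 / (n : ℝ)) ^ n - G (1 / (n : ℝ)) ^ n) atTop (𝓝 0) := by
    set M := Real.exp (‖C‖ + 1)
    have h3 : Tendsto (fun n : ℕ =>
        M * M * (‖F (1 / (n : ℝ)) - G (1 / (n : ℝ))‖ / ‖1 / (n : ℝ)‖)) atTop (𝓝 0) := by
      have := ((hdiff.norm_norm.comp_tendsto hh).tendsto_div_nhds_zero).const_mul (M * M)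
      simpa using this
    refine squeeze_zero_norm' ?_ h3
    filter_upwards [bound h0 hF, bound hG0 hGd] with n hA hB
    refine (tele _ _ M (by positivity) n hA hB).trans_eq ?_
    simp only [norm_div, norm_one, RCLike.norm_natCast, div_div_eq_mul_div, div_one]
    ring
  have hGn : ∀ᶠ n : ℕ in atTop, G (1 / (n : ℝ)) ^ n = NormedSpace.exp C := by
    filter_upwards [eventually_gt_atTop 0] with n hn
    let _ : NormedAlgebra ℚ 𝔸 := NormedAlgebra.restrictScalars ℚ ℝ 𝔸
    rw [hG]
    simp only
    rw [← NormedSpace.exp_nsmul, ← Nat.cast_smul_eq_nsmul ℝ, smul_smul,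
      mul_one_div_cancel (by positivity), one_smul]
  have := hlim.add (tendsto_const_nhds.congr' (hGn.mono fun n hn => hn.symm))
  simpa using this

lemma Matrix.pow_apply_eq_sum_paths {S : Type*} [Fintype S] [DecidableEq S] (M : Matrix S S ℝ)
    (n : ℕ) (i j : S) :
    (M ^ n) i j = ∑ x : Fin (n + 1) → S, if x 0 = i ∧ x (Fin.last n) = j then
      ∏ k : Fin n, M (x k.castSucc) (x k.succ) else 0 := by
  induction n generalizing i with
  | zero =>
    rw [← (Equiv.funUnique (Fin 1) S).symm.sum_comp]
    simp only [pow_zero, Matrix.one_apply, Finset.univ_eq_empty, Finset.prod_empty]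
    by_cases h : i = j
    · subst h; simp [Equiv.funUnique]
    · simp only [h, if_false]
      refine (Finset.sum_eq_zero fun x _ => if_neg ?_).symm
      rintro ⟨rfl, h2⟩
      exact h h2
  | succ n ih =>
    rw [pow_succ', Matrix.mul_apply, ← (Fin.consEquiv fun _ => S).sum_comp, Fintype.sum_prod_type]
    simp only [ih, Finset.mul_sum, Fin.consEquiv_apply, Fin.cons_zero, Fin.prod_univ_succ,
      Fin.castSucc_zero, ← Fin.succ_last, Fin.cons_succ, ← Fin.succ_castSucc]
    refine Finset.sum_comm.trans (Eq.trans ?_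
      (Finset.sum_eq_single i (fun b _ hb => by simp [hb]) (by simp)).symm)
    refine Finset.sum_congr rfl fun x _ => ?_
    rw [Finset.sum_eq_single (x 0) (fun b _ hb => by simp [hb.symm]) (by simp)]
    simp

open scoped Matrix.Norms.Operator in
-- The row vector f(t) e^{(1-t)A} has zero derivative; its values at t = 0 and t = 1 are the two
-- sides.
lemma Matrix.sum_mul_exp_apply_eq_of_hasDerivAt {S : Type*} [Fintype S] [DecidableEq S]
    (A : Matrix S S ℝ) (f : S → ℝ → ℝ)
    (hf : ∀ j t, HasDerivAt (f j) (∑ k, f k t * A k j) t) (j : S) :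
    ∑ k, f k 0 * NormedSpace.exp A k j = f j 1 := by
  have hexp (t : ℝ) (i j : S) : HasDerivAt (fun t : ℝ => NormedSpace.exp (t • A) i j)
      ((A * NormedSpace.exp (t • A)) i j) t := by
    have h := hasDerivAt_exp_smul_const' (𝕂 := ℝ) A t
    exact (⟨Matrix.entryLinearMap ℝ ℝ i j, continuous_id.matrix_elem i j⟩ :
      Matrix S S ℝ →L[ℝ] ℝ).hasFDerivAt.comp_hasDerivAt t h
  have hd (t : ℝ) : HasDerivAt
      (fun t : ℝ => ∑ k, f k t * NormedSpace.exp ((1 - t) • A) k j) 0 t := by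
    have h := HasDerivAt.fun_sum (u := Finset.univ) fun k _ =>
      (hf k t).mul ((hexp (1 - t) k j).comp t ((hasDerivAt_id t).const_sub 1))
    refine h.congr_deriv ?_
    simp only [Matrix.mul_apply, Finset.sum_add_distrib, Finset.sum_mul, Finset.mul_sum,
      Function.comp_apply]
    rw [Finset.sum_comm, ← Finset.sum_add_distrib]
    refine Finset.sum_eq_zero fun k _ => ?_
    rw [← Finset.sum_add_distrib]
    exact Finset.sum_eq_zero fun l _ => by ring
  have hc := is_const_of_deriv_eq_zero (fun t => (hd t).differentiableAt) (fun t => (hd t).deriv) 0 1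
  simpa [NormedSpace.exp_zero, Matrix.one_apply] using hc

/-! ### Occupation time as a limit of Riemann sums. -/

lemma Nat.ceil_mul_eq_succ_of_mem_Ioc {n k : ℕ} (hn : 0 < n) {t : ℝ}
    (ht : t ∈ Ioc ((k : ℝ) / n) ((k + 1 : ℕ) / n)) : ⌈(n : ℝ) * t⌉₊ = k + 1 := by
  have hn' : (0 : ℝ) < n := by exact_mod_cast hn
  obtain ⟨h1, h2⟩ := ht
  rw [div_lt_iff₀ hn'] at h1
  rw [le_div_iff₀ hn'] at h2
  rw [Nat.ceil_eq_iff (by omega)]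
  rw [Nat.add_sub_cancel]
  exact ⟨by linarith, by linarith⟩

/-- For a right-continuous path with values in a discrete space, the right Riemann sums of the time
spent in a state converge to the time spent in that state. -/
lemma tendsto_riemannSum_occupationTime {S : Type*} [DecidableEq S] (f : ℝ≥0 → S)
    (hf : ∀ t : ℝ≥0, ∀ᶠ s in 𝓝[>] t, f s = f t) (i : S) :
    Tendsto (fun n : ℕ => ∑ k : Fin n, (1 / (n : ℝ)) *
      (if f (((k : ℕ) + 1 : ℕ) / (n : ℝ≥0)) = i then 1 else 0)) atTop
      (𝓝 (∫ t in (0 : ℝ)..1, Set.indicator {s : ℝ | f s.toNNReal = i} (fun _ => (1 : ℝ)) t)) := by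
  -- The sum is the integral of the step function sampling f at ⌈nt⌉/n. This point is never before
  -- t, so right-continuity alone gives convergence.
  set F : ℕ → ℝ → ℝ := fun n t => if f ((⌈(n : ℝ) * t⌉₊ : ℝ≥0) / (n : ℝ≥0)) = i then 1 else 0
    with hF
  have hpiece {n : ℕ} (hn : 0 < n) (k : ℕ) : ∀ t ∈ uIoc ((k : ℝ) / n) ((k + 1 : ℕ) / n),
      (if f (((k : ℕ) + 1 : ℕ) / (n : ℝ≥0)) = i then (1 : ℝ) else 0) = F n t := by
    intro t ht
    rw [uIoc_of_le (by gcongr; omega)] at ht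
    simp only [hF, Nat.ceil_mul_eq_succ_of_mem_Ioc hn ht]
  have hint {n : ℕ} (hn : 0 < n) (k : ℕ) :
      IntervalIntegrable (F n) volume ((k : ℝ) / n) ((k + 1 : ℕ) / n) :=
    intervalIntegrable_const.congr (hpiece hn k)
  have hsum {n : ℕ} (hn : 0 < n) : ∑ k : Fin n, (1 / (n : ℝ)) *
      (if f (((k : ℕ) + 1 : ℕ) / (n : ℝ≥0)) = i then 1 else 0) = ∫ t in (0 : ℝ)..1, F n t := by
    have hn' : (n : ℝ) ≠ 0 := by positivity
    have h := intervalIntegral.sum_integral_adjacent_intervals (f := F n) (μ := volume)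
      (a := fun k : ℕ => (k : ℝ) / n) (n := n) fun k _ => hint hn k
    simp only [Nat.cast_zero, zero_div, div_self hn'] at h
    rw [← h, Finset.sum_range]
    refine Finset.sum_congr rfl fun k _ => ?_
    rw [← intervalIntegral.integral_congr_ae (ae_of_all _ (hpiece hn k)),
      intervalIntegral.integral_const, smul_eq_mul]
    congr 1
    push_cast
    ring
  have hlim : Tendsto (fun n => ∫ t in (0 : ℝ)..1, F n t) atTop (𝓝 (∫ t in (0 : ℝ)..1,
      Set.indicator {s : ℝ | f s.toNNReal = i} (fun _ => (1 : ℝ)) t)) := by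
    refine intervalIntegral.tendsto_integral_filter_of_dominated_convergence (fun _ => 1) ?_
      (Eventually.of_forall fun n => ae_of_all _ fun t _ => ?_) intervalIntegrable_const
      (ae_of_all _ fun t ht => ?_)
    · filter_upwards [eventually_gt_atTop 0] with n hn
      have hn' : (n : ℝ) ≠ 0 := by positivity
      have := IntervalIntegrable.trans_iterate (f := F n) (μ := volume)
        (a := fun k : ℕ => (k : ℝ) / n) (n := n) fun k _ => hint hn k
      simp only [Nat.cast_zero, zero_div, div_self hn'] at this
      exact this.aestronglyMeasurable_restrict_uIoc
    · simp only [hF]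
      split_ifs <;> simp
    · rw [uIoc_of_le zero_le_one] at ht
      have ht0 : 0 ≤ t := ht.1.le
      -- The point t itself must be included, since ⌈nt⌉/n may equal t.
      have hge : ∀ᶠ s in 𝓝[≥] t.toNNReal, f s = f t.toNNReal := by
        rw [← Ioi_insert, nhdsWithin_insert]
        exact eventually_sup.2 ⟨by simp, hf _⟩
      have htend : Tendsto (fun n : ℕ => (⌈(n : ℝ) * t⌉₊ : ℝ≥0) / (n : ℝ≥0)) atTop
          (𝓝[≥] t.toNNReal) := by
        refine tendsto_nhdsWithin_iff.2 ⟨?_, ?_⟩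
        · rw [← NNReal.tendsto_coe]
          have := (tendsto_nat_ceil_mul_div_atTop ht0).comp
            (tendsto_natCast_atTop_atTop (R := ℝ))
          simpa [Function.comp_def, mul_comm, Real.coe_toNNReal t ht0] using this
        · filter_upwards [eventually_gt_atTop 0] with n hn
          have hn' : (0 : ℝ) < n := by exact_mod_cast hn
          rw [mem_Ici, ← NNReal.coe_le_coe, Real.coe_toNNReal t ht0]
          push_cast
          rw [le_div_iff₀ hn', mul_comm]
          exact Nat.le_ceil _
      refine tendsto_const_nhds.congr' ?_
      filter_upwards [htend.eventually hge] with n hn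
      simp only [hF, hn, indicator_apply, mem_ofPred_eq]
  refine hlim.congr' ?_
  filter_upwards [eventually_gt_atTop 0] with n hn using (hsum hn).symm

lemma occupationTime_mem_Icc {Ω S : Type*} (X : ℝ≥0 → Ω → S) (i₀ : S) (ω : Ω) :
    occupationTime X i₀ ω ∈ Icc (0 : ℝ) 1 := by
  refine ⟨intervalIntegral.integral_nonneg zero_le_one fun t _ =>
    indicator_nonneg (fun _ _ => zero_le_one) t, ?_⟩
  have h := intervalIntegral.norm_integral_le_of_norm_le_const (a := 0) (b := 1) (C := 1)
    (f := Set.indicator {s : ℝ | X s.toNNReal ω = i₀} (fun _ => (1 : ℝ)))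
    fun t _ => (norm_indicator_le_norm_self _ _).trans (by simp)
  rw [sub_zero, abs_one, mul_one, Real.norm_eq_abs] at h
  exact (le_abs_self _).trans h

/-! ### Feynman–Kac formula. -/

open scoped Matrix.Norms.Operator in
lemma tendsto_exp_mul_diagonal_pow {S : Type*} [Fintype S] [DecidableEq S] [Nonempty S]
    (Q : Matrix S S ℝ) (d : S → ℝ) :
    Tendsto (fun n : ℕ => (NormedSpace.exp ((1 / (n : ℝ)) • Q) * Matrix.diagonal fun k =>
      Real.exp ((1 / (n : ℝ)) * d k)) ^ n) atTop (𝓝 (NormedSpace.exp (Q + Matrix.diagonal d))) := by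
  have hd (h : ℝ) : Matrix.diagonal (fun k => Real.exp (h * d k)) =
      NormedSpace.exp (h • Matrix.diagonal d) := by
    rw [← Matrix.diagonal_smul, Matrix.exp_diagonal, Pi.exp_def]
    congr 1
    ext k
    simp [Real.exp_eq_exp_ℝ]
  simp_rw [hd]
  refine tendsto_pow_one_div_of_hasDerivAt
    (F := fun h : ℝ => NormedSpace.exp (h • Q) * NormedSpace.exp (h • Matrix.diagonal d)) ?_ ?_
  · simp [NormedSpace.exp_zero]
  · exact ((hasDerivAt_exp_smul_const (𝕂 := ℝ) Q 0).mul
      (hasDerivAt_exp_smul_const (𝕂 := ℝ) (Matrix.diagonal d) 0)).congr_deriv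
      (by simp [NormedSpace.exp_zero])

lemma IsCTMC.tendsto_riemannSum {Ω S : Type*} [MeasurableSpace Ω] [Fintype S] [DecidableEq S]
    [MeasurableSpace S] {Q : Matrix S S ℝ} {X : ℝ≥0 → Ω → S} {P : Measure Ω}
    (hX : IsCTMC Q X P) (i₀ : S) : ∀ᵐ ω ∂P,
    Tendsto (fun n : ℕ => ∑ k : Fin n, (1 / (n : ℝ)) *
      (if X (((k : ℕ) + 1 : ℕ) / (n : ℝ≥0)) ω = i₀ then 1 else 0)) atTop
      (𝓝 (occupationTime X i₀ ω)) := by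
  filter_upwards [hX.right_continuous] with ω hω
  exact tendsto_riemannSum_occupationTime (fun t => X t ω) hω i₀

section Chain

variable {Ω S : Type*} [MeasurableSpace Ω] [Fintype S] [DecidableEq S] [MeasurableSpace S]
  [MeasurableSingletonClass S] {Q : Matrix S S ℝ} {X : ℝ≥0 → Ω → S} {P : Measure Ω}

/-- The integrand depends only on the chain at the grid points, so both sides are sums over paths of
length n. Each step is weighted at its right endpoint, hence the diagonal factor stands to the right
of the transition matrix. -/
lemma IsCTMC.integral_exp_riemannSum [IsFiniteMeasure P] (hX : IsCTMC Q X P) (i₀ i j : S) (s : ℝ)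
    {n : ℕ} (hn : 0 < n) :
    ∫ ω, (if X 0 ω = i ∧ X 1 ω = j then Real.exp (s * ∑ k : Fin n, (1 / (n : ℝ)) *
      (if X (((k : ℕ) + 1 : ℕ) / (n : ℝ≥0)) ω = i₀ then 1 else 0)) else 0) ∂P =
    P.real {ω | X 0 ω = i} * ((NormedSpace.exp ((1 / (n : ℝ)) • Q) * Matrix.diagonal fun k =>
      Real.exp ((1 / (n : ℝ)) * (s * if k = i₀ then 1 else 0))) ^ n) i j := by
  set t : Fin (n + 1) → ℝ≥0 := fun k => (k : ℕ) / (n : ℝ≥0) with ht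
  have htm : Monotone t := fun a b hab => by
    simp only [ht]
    gcongr
    exact hab
  have ht0 : t 0 = 0 := by simp [ht]
  have ht1 : t (Fin.last n) = 1 := by simp [ht, hn.ne']
  set Y : Ω → Fin (n + 1) → S := fun ω k => X (t k) ω with hY
  have hYm : Measurable Y := measurable_pi_lambda _ fun k => hX.measurable _
  set M := NormedSpace.exp ((1 / (n : ℝ)) • Q) * Matrix.diagonal fun k =>
      Real.exp ((1 / (n : ℝ)) * (s * if k = i₀ then 1 else 0)) with hM
  set g : (Fin (n + 1) → S) → ℝ := fun x => if x 0 = i ∧ x (Fin.last n) = j then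
    ∏ k : Fin n, Real.exp ((1 / (n : ℝ)) * (s * if x k.succ = i₀ then 1 else 0)) else 0 with hg
  have hgY (ω : Ω) : (if X 0 ω = i ∧ X 1 ω = j then Real.exp (s * ∑ k : Fin n, (1 / (n : ℝ)) *
      (if X (((k : ℕ) + 1 : ℕ) / (n : ℝ≥0)) ω = i₀ then 1 else 0)) else 0) = g (Y ω) := by
    simp only [hg, hY, ht0, ht1, ← Real.exp_sum]
    congr 2
    rw [Finset.mul_sum]
    refine Finset.sum_congr rfl fun k _ => ?_
    simp only [ht, Fin.val_succ]
    ring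
  simp_rw [hgY]
  rw [← integral_map (f := g) hYm.aemeasurable (measurable_of_finite g).aestronglyMeasurable,
    integral_fintype .of_finite, Matrix.pow_apply_eq_sum_paths, Finset.mul_sum]
  refine Finset.sum_congr rfl fun x _ => ?_
  rw [map_measureReal_apply hYm (measurableSet_singleton x)]
  have hset : Y ⁻¹' {x} = {ω | ∀ k, X (t k) ω = x k} := by
    ext ω
    simp [hY, funext_iff]
  rw [hset, hX.markov n t htm x, ht0]
  simp only [hg]
  split_ifs with h
  · rw [h.1, smul_eq_mul, mul_assoc, ← Finset.prod_mul_distrib]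
    congr 1
    refine Finset.prod_congr rfl fun k _ => ?_
    rw [hM, Matrix.mul_diagonal]
    congr 4
    simp [ht, ← sub_div]
  · simp

lemma IsCTMC.measurable_riemannSum (hX : IsCTMC Q X P) (i₀ : S) (n : ℕ) :
    Measurable fun ω => ∑ k : Fin n, (1 / (n : ℝ)) *
      (if X (((k : ℕ) + 1 : ℕ) / (n : ℝ≥0)) ω = i₀ then (1 : ℝ) else 0) :=
  Finset.measurable_sum _ fun _ _ => (Measurable.ite
    (hX.measurable _ (measurableSet_singleton i₀)) measurable_const measurable_const).const_mul _

/-- The pathwise integral is controlled only for almost every path, so measurability comes from the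
almost sure limit of Riemann sums. -/
lemma IsCTMC.aemeasurable_occupationTime (hX : IsCTMC Q X P) (i₀ : S) :
    AEMeasurable (occupationTime X i₀) P :=
  aemeasurable_of_tendsto_metrizable_ae atTop
    (fun n => (hX.measurable_riemannSum i₀ n).aemeasurable) (hX.tendsto_riemannSum i₀)

/-- A Feynman–Kac formula for the time spent in a state. -/
lemma IsCTMC.integral_exp_occupationTime [IsFiniteMeasure P] (hX : IsCTMC Q X P) (i₀ i j : S)
    (s : ℝ) :
    ∫ ω, (if X 0 ω = i ∧ X 1 ω = j then Real.exp (s * occupationTime X i₀ ω) else 0) ∂P =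
      P.real {ω | X 0 ω = i} *
        NormedSpace.exp (Q + Matrix.diagonal fun k => s * if k = i₀ then 1 else 0) i j := by
  have : Nonempty S := ⟨i⟩
  have hmeas : MeasurableSet {ω | X 0 ω = i ∧ X 1 ω = j} :=
    (hX.measurable 0 (measurableSet_singleton i)).inter
      (hX.measurable 1 (measurableSet_singleton j))
  -- The Riemann sums lie in [0, 1], so e^{|s|} dominates. The same integrals converge to the matrix
  -- exponential by Lie–Trotter, and limits are unique.
  have h1 := tendsto_integral_filter_of_dominated_convergence (μ := P) (l := atTop)
    (F := fun (n : ℕ) ω => if X 0 ω = i ∧ X 1 ω = j then Real.exp (s * ∑ k : Fin n,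
      (1 / (n : ℝ)) * (if X (((k : ℕ) + 1 : ℕ) / (n : ℝ≥0)) ω = i₀ then 1 else 0)) else 0)
    (f := fun ω => if X 0 ω = i ∧ X 1 ω = j then Real.exp (s * occupationTime X i₀ ω) else 0)
    (fun _ => Real.exp |s|) (Eventually.of_forall fun n => (Measurable.ite hmeas
      ((hX.measurable_riemannSum i₀ n).const_mul s).exp measurable_const).aestronglyMeasurable)
    (Eventually.of_forall fun n => ae_of_all _ fun ω => ?_) (integrable_const _) ?_
  · have h2 := (((tendsto_exp_mul_diagonal_pow Q fun k =>
      s * if k = i₀ then 1 else 0).apply_nhds i).apply_nhds j).const_mul (P.real {ω | X 0 ω = i})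
    refine tendsto_nhds_unique h1 (h2.congr' ?_)
    filter_upwards [eventually_gt_atTop 0] with n hn
    exact (hX.integral_exp_riemannSum i₀ i j s hn).symm
  · have hle : ∑ k : Fin n, (1 / (n : ℝ)) *
        (if X (((k : ℕ) + 1 : ℕ) / (n : ℝ≥0)) ω = i₀ then (1 : ℝ) else 0) ≤ 1 := by
      calc _ ≤ ∑ k : Fin n, (1 / (n : ℝ)) := by
            refine Finset.sum_le_sum fun k _ => mul_le_of_le_one_right (by positivity) ?_
            split_ifs <;> simp
        _ ≤ 1 := by
            rw [Finset.sum_const, Finset.card_univ, Fintype.card_fin, nsmul_eq_mul, mul_one_div]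
            exact div_self_le_one _
    have hnonneg : 0 ≤ ∑ k : Fin n, (1 / (n : ℝ)) *
        (if X (((k : ℕ) + 1 : ℕ) / (n : ℝ≥0)) ω = i₀ then (1 : ℝ) else 0) := by
      positivity
    split_ifs
    · rw [Real.norm_of_nonneg (Real.exp_pos _).le, Real.exp_le_exp]
      refine (le_abs_self _).trans ?_
      rw [abs_mul, abs_of_nonneg hnonneg]
      exact mul_le_of_le_one_right (abs_nonneg s) hle
    · simpa using (Real.exp_pos _).le
  · filter_upwards [hX.tendsto_riemannSum i₀] with ω hω
    split_ifs
    · exact (Real.continuous_exp.tendsto _).comp (hω.const_mul s)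
    · exact tendsto_const_nhds

end Chain

/-! ### Identifying measures by their moment generating functions. -/

/-- Equality on the real line extends analytically to the complex plane, in particular to the
imaginary axis, where it is equality of characteristic functions. -/
lemma MeasureTheory.Measure.ext_of_mgf_id_eq {ν ν' : Measure ℝ} [IsFiniteMeasure ν]
    [IsFiniteMeasure ν'] (hint : ∀ s : ℝ, Integrable (fun x => Real.exp (s * x)) ν)
    (h : mgf id ν = mgf id ν') : ν = ν' := by
  -- The value at 0 is the total mass.
  have h0 : ν = 0 ↔ ν' = 0 := by
    have := congr_fun h 0
    simp only [mgf_zero'] at this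
    rw [← Measure.measure_univ_eq_zero, ← Measure.measure_univ_eq_zero,
      ← measureReal_eq_zero_iff, ← measureReal_eq_zero_iff, this]
  have huniv : integrableExpSet id ν = univ := eq_univ_of_forall hint
  refine Measure.ext_of_complexMGF_id_eq (funext fun z => ?_)
  exact eqOn_complexMGF_of_mgf' h h0 (by simp [huniv])

/-- The measure with an atom of mass `a` at `x₀` and density `h` on the open unit interval. -/
noncomputable def atomAddDensity (a x₀ : ℝ) (h : ℝ → ℝ) : Measure ℝ :=
  ENNReal.ofReal a • Measure.dirac x₀ +
    (volume.restrict (Ioo (0 : ℝ) 1)).withDensity fun r => ENNReal.ofReal (h r)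

lemma isFiniteMeasure_atomAddDensity (a x₀ : ℝ) {h : ℝ → ℝ} (hh : Continuous h) :
    IsFiniteMeasure (atomAddDensity a x₀ h) := by
  have : IsFiniteMeasure ((volume.restrict (Ioo (0 : ℝ) 1)).withDensity
      fun r => ENNReal.ofReal (h r)) :=
    isFiniteMeasure_withDensity_ofReal
      ((hh.integrableOn_Icc (a := 0) (b := 1)).mono_set Ioo_subset_Icc_self).2
  have : IsFiniteMeasure (ENNReal.ofReal a • Measure.dirac x₀) :=
    Measure.smul_finite _ ENNReal.ofReal_ne_top
  unfold atomAddDensity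
  infer_instance

lemma integral_exp_atomAddDensity {a : ℝ} (ha : 0 ≤ a) (x₀ : ℝ) {h : ℝ → ℝ} (hh : Continuous h)
    (hnn : ∀ r ∈ Ioo (0 : ℝ) 1, 0 ≤ h r) (s : ℝ) :
    ∫ r, Real.exp (s * r) ∂atomAddDensity a x₀ h =
      a * Real.exp (s * x₀) + ∫ r in (0 : ℝ)..1, h r * Real.exp (s * r) := by
  have hc : Continuous fun r => Real.exp (s * r) := by fun_prop
  have hm : Measurable fun r => ENNReal.ofReal (h r) := hh.measurable.ennreal_ofReal
  have hcongr : (fun r => (ENNReal.ofReal (h r)).toReal • Real.exp (s * r)) =ᵐ[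
      volume.restrict (Ioo (0 : ℝ) 1)] fun r => h r * Real.exp (s * r) :=
    (ae_restrict_mem measurableSet_Ioo).mono fun r hr => by
      simp [ENNReal.toReal_ofReal (hnn r hr)]
  have hi : IntegrableOn (fun r => h r * Real.exp (s * r)) (Ioo (0 : ℝ) 1) volume :=
    ((hh.mul hc).integrableOn_Icc (a := 0) (b := 1)).mono_set Ioo_subset_Icc_self
  rw [atomAddDensity, integral_add_measure, integral_smul_measure, integral_dirac,
    integral_withDensity_eq_integral_toReal_smul hm (by simp), integral_congr_ae hcongr,
    intervalIntegral.integral_of_le zero_le_one, integral_Ioc_eq_integral_Ioo,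
    ENNReal.toReal_ofReal ha, smul_eq_mul]
  · exact (integrable_dirac (by simp)).smul_measure ENNReal.ofReal_ne_top
  · rw [integrable_withDensity_iff_integrable_smul' hm (by simp)]
    exact (integrable_congr hcongr).2 hi

/-- The exponential prefactor also weights the atom, giving it mass e(x₀). The continuous g replaces
f, which need only be well behaved inside the interval. -/
lemma dirac_add_withDensity_eq_atomAddDensity (x₀ : ℝ) {e f g : ℝ → ℝ} (he : Continuous e)
    (he0 : ∀ r, 0 ≤ e r) (hg : Continuous g) (hfg : ∀ r ∈ Ioo (0 : ℝ) 1, f r = g r) :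
    (Measure.dirac x₀ + (volume.restrict (Ioo (0 : ℝ) 1)).withDensity fun r =>
      ENNReal.ofReal (f r)).withDensity (fun r => ENNReal.ofReal (e r)) =
      atomAddDensity (e x₀) x₀ fun r => e r * g r := by
  have hcongr : (fun r => ENNReal.ofReal (f r)) =ᵐ[volume.restrict (Ioo (0 : ℝ) 1)]
      fun r => ENNReal.ofReal (g r) :=
    (ae_restrict_mem measurableSet_Ioo).mono fun r hr => by simp only [hfg r hr]
  rw [withDensity_add_measure, dirac_withDensity, withDensity_congr_ae hcongr,
    ← withDensity_mul _ hg.measurable.ennreal_ofReal he.measurable.ennreal_ofReal, atomAddDensity]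
  congr 2
  ext r
  rw [Pi.mul_apply, mul_comm, ENNReal.ofReal_mul (he0 r)]

lemma withDensity_eq_atomAddDensity (x₀ : ℝ) {f g : ℝ → ℝ}
    (hfg : ∀ r ∈ Ioo (0 : ℝ) 1, f r = g r) :
    ((volume.restrict (Ioo (0 : ℝ) 1)).withDensity fun r => ENNReal.ofReal (f r)) =
      atomAddDensity 0 x₀ g := by
  have hcongr : (fun r => ENNReal.ofReal (f r)) =ᵐ[volume.restrict (Ioo (0 : ℝ) 1)]
      fun r => ENNReal.ofReal (g r) :=
    (ae_restrict_mem measurableSet_Ioo).mono fun r hr => by simp only [hfg r hr]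
  rw [withDensity_congr_ae hcongr, atomAddDensity]
  simp

lemma occupationLaw_eq_atomAddDensity {Ω : Type*} [MeasurableSpace Ω] {P : Measure Ω}
    [IsFiniteMeasure P] {Q : Matrix (Fin 2) (Fin 2) ℝ} {X : ℝ≥0 → Ω → Fin 2}
    (hX : IsCTMC Q X P) {i : Fin 2} (j : Fin 2) (hi : P {ω | X 0 ω = i} ≠ 0) {a : ℝ} (ha : 0 ≤ a)
    (x₀ : ℝ) {h : ℝ → ℝ} (hh : Continuous h) (hnn : ∀ r ∈ Ioo (0 : ℝ) 1, 0 ≤ h r)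
    (H : ∀ s : ℝ,
      NormedSpace.exp (Q + Matrix.diagonal fun k : Fin 2 => s * if k = 0 then 1 else 0) i j =
      a * Real.exp (s * x₀) + ∫ r in (0 : ℝ)..1, h r * Real.exp (s * r)) :
    occupationLaw P X i j = atomAddDensity a x₀ h := by
  have := isFiniteMeasure_atomAddDensity a x₀ hh
  have hmi : MeasurableSet {ω | X 0 ω = i} := hX.measurable 0 (measurableSet_singleton i)
  have hmj : MeasurableSet {ω | X 1 ω = j} := hX.measurable 1 (measurableSet_singleton j)
  have hae : AEMeasurable (occupationTime X 0)
      ((ProbabilityTheory.cond P {ω | X 0 ω = i}).restrict {ω | X 1 ω = j}) :=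
    (hX.aemeasurable_occupationTime 0).mono_ac
      (Measure.absolutelyContinuous_of_le Measure.restrict_le_self |>.trans
        (cond_absolutelyContinuous (μ := P)))
  have : IsFiniteMeasure (occupationLaw P X i j) := by
    unfold occupationLaw; infer_instance
  have hexp (s : ℝ) : Continuous fun x : ℝ => Real.exp (s * x) := by fun_prop
  refine Measure.ext_of_mgf_id_eq (fun s => ?_) (funext fun s => ?_)
  · rw [occupationLaw, integrable_map_measure (hexp s).aestronglyMeasurable hae]
    refine Integrable.of_bound ((hexp s).measurable.comp_aemeasurable hae).aestronglyMeasurable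
      (Real.exp |s|) (ae_of_all _ fun ω => ?_)
    have hη := occupationTime_mem_Icc X 0 ω
    rw [Function.comp_apply, Real.norm_of_nonneg (Real.exp_pos _).le, Real.exp_le_exp]
    refine (le_abs_self _).trans ?_
    rw [abs_mul, abs_of_nonneg hη.1]
    exact mul_le_of_le_one_right (abs_nonneg s) hη.2
  · simp only [mgf, id]
    rw [integral_exp_atomAddDensity ha x₀ hh hnn, ← H s, occupationLaw,
      integral_map hae (hexp s).aestronglyMeasurable, ProbabilityTheory.cond,
      Measure.restrict_smul, integral_smul_measure, Measure.restrict_restrict hmj,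
      ← integral_indicator (hmj.inter hmi)]
    have hind : (({ω | X 1 ω = j} ∩ {ω | X 0 ω = i}).indicator
        fun ω => Real.exp (s * occupationTime X 0 ω)) =
        fun ω => if X 0 ω = i ∧ X 1 ω = j then Real.exp (s * occupationTime X 0 ω) else 0 := by
      ext ω
      simp [indicator_apply, and_comm]
    -- The normalization of the conditional measure cancels the initial probability in the
    -- Feynman–Kac formula.
    rw [hind, hX.integral_exp_occupationTime 0 i j s, ENNReal.toReal_inv, smul_eq_mul,
      ← mul_assoc, measureReal_def, inv_mul_cancel₀, one_mul]
    exact ENNReal.toReal_ne_zero.2 ⟨hi, measure_ne_top _ _⟩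

/-! ### The two-state matrix exponential and the four laws. -/

lemma exp_two_by_two_zero_apply (x y μ ξ : ℝ) :
    NormedSpace.exp !![x, μ; ξ, y] 0 0 =
        Real.exp x + ∫ u in (0 : ℝ)..1, returnKernel x y (μ * ξ) 1 u ∧
      NormedSpace.exp !![x, μ; ξ, y] 0 1 =
        μ * ∫ u in (0 : ℝ)..1, switchKernel x y (μ * ξ) 1 u := by
  have h := Matrix.sum_mul_exp_apply_eq_of_hasDerivAt !![x, μ; ξ, y]
    ![fun t => Real.exp (x * t) + ∫ u in (0 : ℝ)..1, returnKernel x y (μ * ξ) t u,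
      fun t => μ * ∫ u in (0 : ℝ)..1, switchKernel x y (μ * ξ) t u] (fun j t => by
      fin_cases j
      · refine (hasDerivAt_integral_returnKernel x y (μ * ξ) t).congr_deriv ?_
        simp [Fin.sum_univ_two]
        ring
      · refine ((hasDerivAt_integral_switchKernel x y (μ * ξ) t).const_mul μ).congr_deriv ?_
        simp [Fin.sum_univ_two]
        ring)
  exact ⟨by simpa [Fin.sum_univ_two, returnKernel, switchKernel] using h 0,
    by simpa [Fin.sum_univ_two, returnKernel, switchKernel] using h 1⟩

/-- Exchanging the states swaps x with y and μ with ξ; the variable u then plays the role of the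
time in the second state. -/
lemma exp_two_by_two_one_apply (x y μ ξ : ℝ) :
    NormedSpace.exp !![x, μ; ξ, y] 1 0 =
        ξ * ∫ u in (0 : ℝ)..1, switchKernel y x (μ * ξ) 1 u ∧
      NormedSpace.exp !![x, μ; ξ, y] 1 1 =
        Real.exp y + ∫ u in (0 : ℝ)..1, returnKernel y x (μ * ξ) 1 u := by
  have h := Matrix.sum_mul_exp_apply_eq_of_hasDerivAt !![x, μ; ξ, y]
    ![fun t => ξ * ∫ u in (0 : ℝ)..1, switchKernel y x (μ * ξ) t u,
      fun t => Real.exp (y * t) + ∫ u in (0 : ℝ)..1, returnKernel y x (μ * ξ) t u] (fun j t => by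
      fin_cases j
      · refine ((hasDerivAt_integral_switchKernel y x (μ * ξ) t).const_mul ξ).congr_deriv ?_
        simp [Fin.sum_univ_two]
        ring
      · refine (hasDerivAt_integral_returnKernel y x (μ * ξ) t).congr_deriv ?_
        simp [Fin.sum_univ_two]
        ring)
  exact ⟨by simpa [Fin.sum_univ_two, returnKernel, switchKernel] using h 0,
    by simpa [Fin.sum_univ_two, returnKernel, switchKernel] using h 1⟩

lemma twoStateGenerator_add_diagonal (μ ξ s : ℝ) :
    twoStateGenerator μ ξ + Matrix.diagonal (fun k : Fin 2 => s * if k = 0 then 1 else 0) =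
      !![-μ + s, μ; ξ, -ξ] := by
  ext a b
  fin_cases a <;> fin_cases b <;> simp [twoStateGenerator]

/-- The square root in front and the one in I₁(2√z) = √z · `besselSeries 1 z` multiply to cv, which
removes the singularity at w = 0. -/
lemma sqrt_mul_besselI_one {c v w : ℝ} (hc : 0 ≤ c) (hv : 0 ≤ v) (hw : 0 < w) :
    Real.sqrt (c * v / w) * besselI 1 (2 * Real.sqrt (c * v * w)) =
      c * v * besselSeries 1 (c * v * w) := by
  rw [besselI_one_two_mul_sqrt (by positivity), ← mul_assoc, ← Real.sqrt_mul (by positivity),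
    show c * v / w * (c * v * w) = (c * v) ^ 2 by field_simp, Real.sqrt_sq (by positivity)]

theorem mainTheorem8 {Ω : Type*} [MeasurableSpace Ω] (P : Measure Ω) [IsProbabilityMeasure P]
    (μ ξ : ℝ) (hμ : 0 < μ) (hξ : 0 < ξ) (X : ℝ≥0 → Ω → Fin 2)
    (hX : IsCTMC (twoStateGenerator μ ξ) X P) :
    (P {ω | X 0 ω = 0} ≠ 0 →
      occupationLaw P X 0 0 =
          (Measure.dirac (1 : ℝ) +
            (volume.restrict (Ioo (0 : ℝ) 1)).withDensity (fun r =>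
              ENNReal.ofReal (Real.sqrt (μ * ξ * r / (1 - r)) *
                besselI 1 (2 * Real.sqrt (μ * ξ * r * (1 - r)))))).withDensity
            (fun r => ENNReal.ofReal (Real.exp (-μ * r - ξ * (1 - r)))) ∧
      occupationLaw P X 0 1 =
          (volume.restrict (Ioo (0 : ℝ) 1)).withDensity (fun r =>
            ENNReal.ofReal (μ * Real.exp (-μ * r - ξ * (1 - r)) *
              besselI 0 (2 * Real.sqrt (μ * ξ * r * (1 - r)))))) ∧
    (P {ω | X 0 ω = 1} ≠ 0 →
      occupationLaw P X 1 0 =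
          (volume.restrict (Ioo (0 : ℝ) 1)).withDensity (fun r =>
            ENNReal.ofReal (ξ * Real.exp (-μ * r - ξ * (1 - r)) *
              besselI 0 (2 * Real.sqrt (μ * ξ * r * (1 - r))))) ∧
      occupationLaw P X 1 1 =
          (Measure.dirac (0 : ℝ) +
            (volume.restrict (Ioo (0 : ℝ) 1)).withDensity (fun r =>
              ENNReal.ofReal (Real.sqrt (μ * ξ * (1 - r) / r) *
                besselI 1 (2 * Real.sqrt (μ * ξ * r * (1 - r)))))).withDensity
            (fun r => ENNReal.ofReal (Real.exp (-μ * r - ξ * (1 - r))))) := by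
  have c0 := continuous_besselSeries 0
  have c1 := continuous_besselSeries 1
  have hz {r : ℝ} (hr : r ∈ Ioo (0 : ℝ) 1) : 0 ≤ μ * ξ * r * (1 - r) := by
    have := hr.1.le
    have := sub_nonneg.2 hr.2.le
    positivity
  have he : Continuous fun r : ℝ => Real.exp (-μ * r - ξ * (1 - r)) := by fun_prop
  -- The parameter s enters the kernels only through x = -μ + s (or y after exchanging states), so
  -- it splits off as e^{sr}.
  have hexp (s r : ℝ) {z : ℝ} (h : z = -μ * r - ξ * (1 - r) + s * r) :
      Real.exp z = Real.exp (-μ * r - ξ * (1 - r)) * Real.exp (s * r) := by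
    rw [h, Real.exp_add]
  have hswitch {b : ℝ} (hb : 0 ≤ b) : ∀ r ∈ Ioo (0 : ℝ) 1, 0 ≤ b *
      Real.exp (-μ * r - ξ * (1 - r)) * besselSeries 0 (μ * ξ * r * (1 - r)) := fun r hr =>
    mul_nonneg (mul_nonneg hb (Real.exp_pos _).le) (besselSeries_nonneg 0 (hz hr))
  refine ⟨fun h0 => ⟨?_, ?_⟩, fun h1 => ⟨?_, ?_⟩⟩
  · rw [dirac_add_withDensity_eq_atomAddDensity 1
      (g := fun r => μ * ξ * r * besselSeries 1 (μ * ξ * r * (1 - r))) he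
      (fun r => (Real.exp_pos _).le) (by fun_prop)
      fun r hr => sqrt_mul_besselI_one (by positivity) hr.1.le (sub_pos.2 hr.2)]
    refine occupationLaw_eq_atomAddDensity hX 0 h0 (Real.exp_pos _).le 1 (by fun_prop)
      (fun r hr => mul_nonneg (Real.exp_pos _).le
        (mul_nonneg (mul_nonneg (by positivity) hr.1.le) (besselSeries_nonneg 1 (hz hr))))
      fun s => ?_
    rw [twoStateGenerator_add_diagonal, (exp_two_by_two_zero_apply _ _ _ _).1, ← Real.exp_add]
    congr 2
    · ring
    · ext r
      rw [returnKernel, hexp s r]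
      all_goals ring_nf
  · rw [withDensity_eq_atomAddDensity 0 (g := fun r => μ * Real.exp (-μ * r - ξ * (1 - r)) *
      besselSeries 0 (μ * ξ * r * (1 - r)))
      fun r hr => by rw [besselI_zero_two_mul_sqrt (hz hr)]]
    refine occupationLaw_eq_atomAddDensity hX 1 h0 le_rfl 0 (by fun_prop) (hswitch hμ.le)
      fun s => ?_
    rw [twoStateGenerator_add_diagonal, (exp_two_by_two_zero_apply _ _ _ _).2, zero_mul, zero_add,
      ← intervalIntegral.integral_const_mul]
    congr 1
    ext r
    rw [switchKernel, hexp s r]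
    all_goals ring_nf
  · rw [withDensity_eq_atomAddDensity 0 (g := fun r => ξ * Real.exp (-μ * r - ξ * (1 - r)) *
      besselSeries 0 (μ * ξ * r * (1 - r)))
      fun r hr => by rw [besselI_zero_two_mul_sqrt (hz hr)]]
    refine occupationLaw_eq_atomAddDensity hX 0 h1 le_rfl 0 (by fun_prop) (hswitch hξ.le)
      fun s => ?_
    rw [twoStateGenerator_add_diagonal, (exp_two_by_two_one_apply _ _ _ _).1, zero_mul, zero_add,
      ← intervalIntegral.integral_const_mul]
    -- Starting from the second state, u is the time spent there, so r = 1 - u.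
    have hsub := intervalIntegral.integral_comp_sub_left (a := 0) (b := 1)
      (fun u => ξ * switchKernel (-ξ) (-μ + s) (μ * ξ) 1 u) 1
    rw [sub_self, sub_zero] at hsub
    rw [← hsub]
    congr 1
    ext r
    rw [switchKernel, hexp s r]
    all_goals ring_nf
  · rw [dirac_add_withDensity_eq_atomAddDensity 0
      (g := fun r => μ * ξ * (1 - r) * besselSeries 1 (μ * ξ * (1 - r) * r)) he
      (fun r => (Real.exp_pos _).le) (by fun_prop) fun r hr => by
        rw [mul_right_comm (μ * ξ) r]
        exact sqrt_mul_besselI_one (by positivity) (sub_nonneg.2 hr.2.le) hr.1]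
    refine occupationLaw_eq_atomAddDensity hX 1 h1 (Real.exp_pos _).le 0 (by fun_prop)
      (fun r hr => mul_nonneg (Real.exp_pos _).le (mul_nonneg (mul_nonneg (by positivity)
        (sub_nonneg.2 hr.2.le)) (besselSeries_nonneg 1 (by
          rw [mul_right_comm]; exact hz hr)))) fun s => ?_
    rw [twoStateGenerator_add_diagonal, (exp_two_by_two_one_apply _ _ _ _).2, ← Real.exp_add]
    -- The same reflection r = 1 - u turns time in the second state into time in the first.
    have hsub := intervalIntegral.integral_comp_sub_left (a := 0) (b := 1)
      (fun u => returnKernel (-ξ) (-μ + s) (μ * ξ) 1 u) 1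
    rw [sub_self, sub_zero] at hsub
    rw [← hsub]
    congr 2
    · ring
    · ext r
      rw [returnKernel, hexp s r]
      all_goals ring_nf
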